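/- Let $n\ge 1$ and let $T(z)=\mathrm{i}\,\frac{1+z}{1-z}$, viewed as a bijection of the Riemann sphere $\mathbb C\cup\{\infty\}$ (so $T(1)=\infty$, $T(\infty)=-\mathrm{i}$). A Blaschke product of degree $n$ is a rational function $B(z)=c\prod_{k=1}^n\frac{z-a_k}{1-\overline{a_k}\,z}$ with $|c|=1$ and (not necessarily distinct) $a_1,\dots,a_n$ satisfying $|a_k|<1$. Rational functions are regarded as self-maps of the Riemann sphere. (1) The mapping $B\mapsto T\circ B\circ T^{-1}$ is a bijection from the set of all Blaschke products $B$ of degree $n$ with $B(1)=-1$ onto the set of all rational functions of the form $$f(x)=-\frac{r_1}{x-x_1}-\dots-\frac{r_n}{x-x_n}$$ with real numbers $x_1<x_2<\dots<x_n$ and real $r_k>0$ for $k=1,\dots,n$. (2) The mapping $B\mapsto T\circ B\circ T^{-1}$ is a bijection from the set of all Blaschke products $B$ of degree $n$ with $B(1)=1$ onto the set of all rational functions of the form $$g(x)=ax+b-\frac{s_1}{x-t_1}-\dots-\frac{s_{n-1}}{x-t_{n-1}}$$ with real $a>0$, $b\in\mathbb R$, real numbers $t_1<t_2<\dots<t_{n-1}$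 and real $s_k>0$ for $k=1,\dots,n-1$ (for $n=1$ the sum is empty). -/

import Mathlib

open scoped OnePoint ComplexConjugate

noncomputable section

/-- The self-map of the Riemann sphere `ℂ ∪ {∞}` given by a rational function `R = p / q` in lowest
terms: a finite point is sent to `∞` if it is a pole and to `p(z) / q(z)` otherwise, and `∞` is
sent to the limit of `R` at infinity. -/
def sphereMap (R : RatFunc ℂ) : OnePoint ℂ → OnePoint ℂ
  | ∞ => open Classical in
      if R.denom.natDegree < R.num.natDegree then ∞
      else ((R.num.coeff R.denom.natDegree / R.denom.leadingCoeff : ℂ) : OnePoint ℂ)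
  | (z : ℂ) => open Classical in
      if R.denom.eval z = 0 then ∞
      else ((R.num.eval z / R.denom.eval z : ℂ) : OnePoint ℂ)

/-- The (inverse) Cayley transform `T(z) = i (1 + z) / (1 - z)` on the Riemann sphere. -/
def cayleyFun : OnePoint ℂ → OnePoint ℂ
  | ∞ => ((-Complex.I : ℂ) : OnePoint ℂ)
  | (z : ℂ) => open Classical in
      if z = 1 then ∞ else ((Complex.I * (1 + z) / (1 - z) : ℂ) : OnePoint ℂ)

/-- The inverse `T⁻¹(w) = (w - i) / (w + i)` on the Riemann sphere. -/
def cayleyInvFun : OnePoint ℂ → OnePoint ℂ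
  | ∞ => ((1 : ℂ) : OnePoint ℂ)
  | (w : ℂ) => open Classical in
      if w = -Complex.I then ∞ else (((w - Complex.I) / (w + Complex.I) : ℂ) : OnePoint ℂ)

theorem cayleyInvFun_cayleyFun (z : OnePoint ℂ) : cayleyInvFun (cayleyFun z) = z := by
  have hI := Complex.I_ne_zero
  induction z using OnePoint.rec with
  | infty => simp [cayleyFun, cayleyInvFun]
  | coe z =>
    by_cases h : z = 1
    · simp [cayleyFun, cayleyInvFun, h]
    · have h1 : (1 - z) ≠ 0 := sub_ne_zero.mpr (Ne.symm h)
      have h3 : Complex.I * (1 + z) / (1 - z) + Complex.I = 2 * Complex.I / (1 - z) := by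
        field_simp; ring
      have h4 : Complex.I * (1 + z) / (1 - z) - Complex.I = 2 * Complex.I * z / (1 - z) := by
        field_simp; ring
      have h2 : Complex.I * (1 + z) / (1 - z) ≠ -Complex.I := by
        rw [ne_eq, ← add_eq_zero_iff_eq_neg, h3]
        simp [h1]
      simp only [cayleyFun, cayleyInvFun, if_neg h, if_neg h2, h3, h4]
      congr 1
      field_simp

theorem cayleyFun_cayleyInvFun (w : OnePoint ℂ) : cayleyFun (cayleyInvFun w) = w := by
  have hI := Complex.I_ne_zero
  induction w using OnePoint.rec with
  | infty => simp [cayleyFun, cayleyInvFun]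
  | coe w =>
    by_cases h : w = -Complex.I
    · simp [cayleyFun, cayleyInvFun, h]
    · have h1 : w + Complex.I ≠ 0 := by rwa [ne_eq, add_eq_zero_iff_eq_neg]
      have h3 : 1 - (w - Complex.I) / (w + Complex.I) = 2 * Complex.I / (w + Complex.I) := by
        field_simp; ring
      have h4 : 1 + (w - Complex.I) / (w + Complex.I) = 2 * w / (w + Complex.I) := by
        field_simp; ring
      have h2 : (w - Complex.I) / (w + Complex.I) ≠ 1 := by
        rw [ne_eq, eq_comm, ← sub_eq_zero, h3]
        simp [h1]
      simp only [cayleyFun, cayleyInvFun, if_neg h, if_neg h2, h3, h4]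
      congr 1
      field_simp

/-- The Cayley transform `T` as a bijection of the Riemann sphere. -/
def cayley : OnePoint ℂ ≃ OnePoint ℂ where
  toFun := cayleyFun
  invFun := cayleyInvFun
  left_inv := cayleyInvFun_cayleyFun
  right_inv := cayleyFun_cayleyInvFun

/-- Conjugation `B ↦ T ∘ B ∘ T⁻¹` by the Cayley transform. -/
def cayleyConj (B : OnePoint ℂ → OnePoint ℂ) : OnePoint ℂ → OnePoint ℂ :=
  cayley ∘ B ∘ cayley.symm

/-- The rational function `c ∏ₖ (z - aₖ) / (1 - conj aₖ z)`. -/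
def blaschkeRat {n : ℕ} (c : ℂ) (a : Fin n → ℂ) : RatFunc ℂ :=
  RatFunc.C c *
    ∏ k, (RatFunc.X - RatFunc.C (a k)) / (1 - RatFunc.C (conj (a k)) * RatFunc.X)

/-- Finite Blaschke products of degree `n`, as self-maps of the Riemann sphere. -/
def IsBlaschkeProduct (n : ℕ) (B : OnePoint ℂ → OnePoint ℂ) : Prop :=
  ∃ (c : ℂ) (a : Fin n → ℂ), ‖c‖ = 1 ∧ (∀ k, ‖a k‖ < 1) ∧ B = sphereMap (blaschkeRat c a)

/-- The rational function `∑ₖ rₖ / (x - xₖ)`, with real residues and real poles. -/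
def partialFractions {m : ℕ} (r x : Fin m → ℝ) : RatFunc ℂ :=
  ∑ k, RatFunc.C (r k : ℂ) / (RatFunc.X - RatFunc.C (x k : ℂ))

/-- The rational functions `-∑ₖ rₖ / (x - xₖ)` with `x₁ < ⋯ < xₙ` and all `rₖ > 0`, as self-maps of
the Riemann sphere. -/
def IsVanishingAtInftyFun (n : ℕ) (f : OnePoint ℂ → OnePoint ℂ) : Prop :=
  ∃ r x : Fin n → ℝ, StrictMono x ∧ (∀ k, 0 < r k) ∧ f = sphereMap (-partialFractions r x)

/-- The rational functions `a x + b - ∑ₖ sₖ / (x - tₖ)` with `a > 0`, `b` real, `t₁ < ⋯ < tₘ` and all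
`sₖ > 0`, as self-maps of the Riemann sphere. -/
def IsPoleAtInftyFun (m : ℕ) (g : OnePoint ℂ → OnePoint ℂ) : Prop :=
  ∃ (a b : ℝ) (s t : Fin m → ℝ), 0 < a ∧ StrictMono t ∧ (∀ k, 0 < s k) ∧
    g = sphereMap (RatFunc.C (a : ℂ) * RatFunc.X + RatFunc.C (b : ℂ) - partialFractions s t)

end

/-! Let `ε = B(1)` and let `α k = T(a k)`, a point of the upper half-plane. In the coordinate `w`
with `z = T⁻¹(w)`, each Blaschke factor becomes `(w - α k) / (w - conj (α k))` up to a constant.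
Hence `B ∘ T⁻¹ = ε E / E*`, where `E = ∏ (w - α k)` and `E*` has the conjugate roots. Splitting
coefficients into real and imaginary parts gives `E = A + iD` and `E* = A - iD` with `A`, `D` real.
Applying `T` yields `D / A` for `ε = -1` and `-A / D` for `ε = 1`.

From Blaschke products to partial fractions: off the real axis `|E| ≠ |E*|`, so `A` and `D` have
only real roots (`im_eq_zero_of_norm_eq`). The Wronskian `D'A - A'D` is positive on the real line
(`wronskian_pos`), which makes these roots simple and all the residues negative.

Conversely, given a function of either form, written as `D / A` or `-A / D`, the roots of `A + iD`
are the points where it takes the value `i = T(0)`. Such a function maps no point of the closed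
lower half-plane to `i` (`im_pos_of_partialFractions`). So these roots lie in the upper half-plane,
and their images under `T⁻¹` are the zeros of the required Blaschke product. -/

open Polynomial

/-! ### Homogeneous coordinates on the Riemann sphere -/

/-- The point `[u : v]` of the Riemann sphere. -/
noncomputable def spherePoint (u v : ℂ) : OnePoint ℂ :=
  open Classical in if v = 0 then ∞ else ((u / v : ℂ) : OnePoint ℂ)

theorem spherePoint_mul_left {t : ℂ} (ht : t ≠ 0) (u v : ℂ) :
    spherePoint (t * u) (t * v) = spherePoint u v := by
  by_cases hv : v = 0
  · simp [spherePoint, hv]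
  · simp [spherePoint, hv, ht, mul_div_mul_left]

theorem spherePoint_eq_of_mul_eq {s t u v u' v' : ℂ} (hs : s ≠ 0) (ht : t ≠ 0)
    (hu : s * u = t * u') (hv : s * v = t * v') : spherePoint u v = spherePoint u' v' := by
  rw [← spherePoint_mul_left hs, hu, hv, spherePoint_mul_left ht]

theorem spherePoint_eq_coe_iff {u v w : ℂ} :
    spherePoint u v = (w : OnePoint ℂ) ↔ v ≠ 0 ∧ u = w * v := by
  by_cases hv : v = 0
  · simp [spherePoint, hv]
  · simp [spherePoint, hv, div_eq_iff]

/-- `T` acts as a matrix on homogeneous coordinates. The hypothesis excludes `[0 : 0]`, to which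
`spherePoint` assigns the default value `∞` and for which the formula fails. -/
theorem cayley_spherePoint {u v : ℂ} (h : u ≠ 0 ∨ v ≠ 0) :
    cayley (spherePoint u v) = spherePoint (Complex.I * (v + u)) (v - u) := by
  by_cases hv : v = 0
  · have hu : u ≠ 0 := by simpa [hv] using h
    simp [spherePoint, hv, hu, cayley, cayleyFun, div_neg]
  · by_cases huv : u = v
    · subst huv
      simp [spherePoint, hv, cayley, cayleyFun]
    · have h1 : u / v ≠ 1 := by rwa [ne_eq, div_eq_one_iff_eq hv]
      have h2 : v - u ≠ 0 := sub_ne_zero.mpr (Ne.symm huv)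
      have h3 : 1 - u / v ≠ 0 := sub_ne_zero.mpr h1.symm
      simp only [spherePoint, hv, if_false, cayley, cayleyFun, Equiv.coe_fn_mk, h1, h2]
      congr 1
      rw [div_eq_div_iff h3 h2]
      field_simp

theorem cayley_symm_coe (w : ℂ) :
    cayley.symm (w : OnePoint ℂ) = spherePoint (w - Complex.I) (w + Complex.I) := by
  simp [cayley, cayleyInvFun, spherePoint, add_eq_zero_iff_eq_neg]

theorem exists_num_denom_div {P Q : ℂ[X]} (h : IsCoprime P Q) (hQ : Q ≠ 0) :
    ∃ t : ℂ, t ≠ 0 ∧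
      (algebraMap ℂ[X] (RatFunc ℂ) P / algebraMap ℂ[X] (RatFunc ℂ) Q).num = C t * P ∧
      (algebraMap ℂ[X] (RatFunc ℂ) P / algebraMap ℂ[X] (RatFunc ℂ) Q).denom = C t * Q := by
  classical
  have hg : gcd P Q = 1 := by
    rw [← normalize_gcd, normalize_eq_one]
    exact h.isUnit_of_dvd' (gcd_dvd_left P Q) (gcd_dvd_right P Q)
  have hone : ∀ p : ℂ[X], p / 1 = p := fun p => EuclideanDomain.div_one p
  refine ⟨Q.leadingCoeff⁻¹, inv_ne_zero (leadingCoeff_ne_zero.mpr hQ), ?_, ?_⟩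
  · rw [RatFunc.num_div, hg, hone, hone]
  · rw [RatFunc.denom_div _ hQ, hg, hone]

theorem sphereMap_div_coe {P Q : ℂ[X]} (h : IsCoprime P Q) (hQ : Q ≠ 0) (z : ℂ) :
    sphereMap (algebraMap ℂ[X] (RatFunc ℂ) P / algebraMap ℂ[X] (RatFunc ℂ) Q) (z : OnePoint ℂ) =
      spherePoint (P.eval z) (Q.eval z) := by
  obtain ⟨t, ht, hnum, hden⟩ := exists_num_denom_div h hQ
  simp only [sphereMap, hnum, hden, eval_mul, eval_C]
  exact spherePoint_mul_left ht _ _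

/-- Homogenizing both polynomials to a common degree `n`, the value at `∞` is the ratio of the
coefficients of degree `n`; neither of them has to be a leading coefficient. -/
theorem sphereMap_div_infty {P Q : ℂ[X]} {n : ℕ} (h : IsCoprime P Q) (hQ : Q ≠ 0)
    (hPn : P.natDegree ≤ n) (hQn : Q.natDegree ≤ n) (hn : P.coeff n ≠ 0 ∨ Q.coeff n ≠ 0) :
    sphereMap (algebraMap ℂ[X] (RatFunc ℂ) P / algebraMap ℂ[X] (RatFunc ℂ) Q) ∞ =
      spherePoint (P.coeff n) (Q.coeff n) := by
  obtain ⟨t, ht, hnum, hden⟩ := exists_num_denom_div h hQ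
  simp only [sphereMap, hnum, hden, natDegree_C_mul ht, leadingCoeff_mul, leadingCoeff_C,
    coeff_C_mul]
  by_cases hc : Q.coeff n = 0
  · have hPc : P.coeff n ≠ 0 := by simpa [hc] using hn
    have h1 : P.natDegree = n := le_antisymm hPn (le_natDegree_of_ne_zero hPc)
    have h2 : Q.natDegree < P.natDegree := by
      rw [h1]
      refine lt_of_le_of_ne hQn fun h3 => hQ ?_
      rw [← leadingCoeff_eq_zero, leadingCoeff, h3, hc]
    simp [spherePoint, hc, h2]
  · have h1 : Q.natDegree = n := le_antisymm hQn (le_natDegree_of_ne_zero hc)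
    have h2 : ¬ Q.natDegree < P.natDegree := by rw [h1]; exact not_lt.mpr hPn
    rw [if_neg h2, spherePoint, if_neg hc, leadingCoeff, h1, mul_div_mul_left _ _ ht]

/-! ### Blaschke products in homogeneous coordinates -/

section Blaschke

variable {n : ℕ}

/-- The numerator of a Blaschke product. -/
noncomputable def blaschkeNum (c : ℂ) (a : Fin n → ℂ) : ℂ[X] := C c * ∏ k, (X - C (a k))

/-- The denominator of a Blaschke product. -/
noncomputable def blaschkeDen (a : Fin n → ℂ) : ℂ[X] := ∏ k, (1 - C (conj (a k)) * X)

theorem blaschkeRat_eq_div (c : ℂ) (a : Fin n → ℂ) :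
    blaschkeRat c a = algebraMap ℂ[X] (RatFunc ℂ) (blaschkeNum c a) /
      algebraMap ℂ[X] (RatFunc ℂ) (blaschkeDen a) := by
  simp [blaschkeRat, blaschkeNum, blaschkeDen, mul_div_assoc, Finset.prod_div_distrib]

theorem mul_conj_ne_one {a b : ℂ} (ha : ‖a‖ < 1) (hb : ‖b‖ < 1) : 1 - conj b * a ≠ 0 := by
  intro h
  have h1 : conj b * a = 1 := (sub_eq_zero.mp h).symm
  have h2 : ‖b‖ * ‖a‖ = 1 := by simpa using congrArg norm h1
  nlinarith [norm_nonneg a, norm_nonneg b]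

theorem isCoprime_blaschke {c : ℂ} (hc : c ≠ 0) {a : Fin n → ℂ} (ha : ∀ k, ‖a k‖ < 1) :
    IsCoprime (blaschkeNum c a) (blaschkeDen a) := by
  refine (isCoprime_mul_unit_left_left (isUnit_C.mpr hc.isUnit) _ _).mpr ?_
  refine IsCoprime.prod_left fun i _ => IsCoprime.prod_right fun j _ => ?_
  have h := mul_conj_ne_one (ha i) (ha j)
  -- Bézout identity: `conj (a j) * (X - a i) + (1 - conj (a j) * X)` is the nonzero constant `1 -
  -- conj (a j) * a i`.
  refine ⟨C ((1 - conj (a j) * a i)⁻¹ * conj (a j)), C ((1 - conj (a j) * a i)⁻¹), ?_⟩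
  have h1 : C ((1 - conj (a j) * a i)⁻¹) * (1 - C (conj (a j)) * C (a i)) = 1 := by
    rw [← C_mul, ← C_1, ← C_sub, ← C_mul, inv_mul_cancel₀ h]
  rw [C_mul]
  linear_combination h1

theorem blaschkeDen_ne_zero (a : Fin n → ℂ) : blaschkeDen a ≠ 0 := by
  refine Finset.prod_ne_zero_iff.mpr fun k _ h => ?_
  simpa using congrArg (eval 0) h

theorem eval_blaschkeNum (c : ℂ) (a : Fin n → ℂ) (z : ℂ) :
    (blaschkeNum c a).eval z = c * ∏ k, (z - a k) := by
  simp [blaschkeNum, eval_prod]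

theorem eval_blaschkeDen (a : Fin n → ℂ) (z : ℂ) :
    (blaschkeDen a).eval z = ∏ k, (1 - conj (a k) * z) := by
  simp [blaschkeDen, eval_prod]

theorem natDegree_prod_X_sub_C (a : Fin n → ℂ) : (∏ k, (X - C (a k))).natDegree = n := by
  simp

theorem coeff_prod_X_sub_C (a : Fin n → ℂ) : (∏ k, (X - C (a k))).coeff n = 1 := by
  have h := (monic_prod_X_sub_C a Finset.univ).coeff_natDegree
  rwa [natDegree_prod_X_sub_C] at h

theorem natDegree_one_sub_C_mul_X_le (b : ℂ) : (1 - C b * X : ℂ[X]).natDegree ≤ 1 := by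
  compute_degree

theorem natDegree_blaschkeDen_le (a : Fin n → ℂ) : (blaschkeDen a).natDegree ≤ n := by
  refine (natDegree_prod_le _ _).trans ?_
  refine (Finset.sum_le_sum fun k _ => natDegree_one_sub_C_mul_X_le (conj (a k))).trans ?_
  simp

/-- Some `a k` may be `0`, so the denominator can have degree below `n`; the coefficient of degree
`n` still encodes the value at `∞`. -/
theorem coeff_blaschkeDen (a : Fin n → ℂ) : (blaschkeDen a).coeff n = ∏ k, (-conj (a k)) := by
  have h := coeff_prod_of_natDegree_le (Finset.univ : Finset (Fin n))
    (fun k => (1 - C (conj (a k)) * X : ℂ[X])) 1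
    (fun k _ => natDegree_one_sub_C_mul_X_le _)
  simpa [blaschkeDen, coeff_one] using h

theorem sphereMap_blaschkeRat_coe {c : ℂ} (hc : c ≠ 0) {a : Fin n → ℂ} (ha : ∀ k, ‖a k‖ < 1)
    (z : ℂ) : sphereMap (blaschkeRat c a) (z : OnePoint ℂ) =
      spherePoint (c * ∏ k, (z - a k)) (∏ k, (1 - conj (a k) * z)) := by
  rw [blaschkeRat_eq_div, sphereMap_div_coe (isCoprime_blaschke hc ha) (blaschkeDen_ne_zero a),
    eval_blaschkeNum, eval_blaschkeDen]

theorem sphereMap_blaschkeRat_infty {c : ℂ} (hc : c ≠ 0) {a : Fin n → ℂ} (ha : ∀ k, ‖a k‖ < 1) :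
    sphereMap (blaschkeRat c a) ∞ = spherePoint c (∏ k, (-conj (a k))) := by
  have h1 : (blaschkeNum c a).coeff n = c := by
    rw [blaschkeNum, coeff_C_mul, coeff_prod_X_sub_C, mul_one]
  have h2 : (blaschkeNum c a).natDegree ≤ n := by
    rw [blaschkeNum, natDegree_C_mul hc, natDegree_prod_X_sub_C]
  rw [blaschkeRat_eq_div, sphereMap_div_infty (isCoprime_blaschke hc ha) (blaschkeDen_ne_zero a)
    h2 (natDegree_blaschkeDen_le a) (Or.inl (h1.symm ▸ hc)), h1, coeff_blaschkeDen]

/-- The homogenized form of `sphereMap` of a Blaschke product at the point `T⁻¹(w)`. -/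
theorem sphereMap_blaschkeRat_cayley_symm {c : ℂ} (hc : c ≠ 0) {a : Fin n → ℂ}
    (ha : ∀ k, ‖a k‖ < 1) (w : ℂ) :
    sphereMap (blaschkeRat c a) (cayley.symm (w : OnePoint ℂ)) =
      spherePoint (c * ∏ k, ((w - Complex.I) - a k * (w + Complex.I)))
        (∏ k, ((w + Complex.I) - conj (a k) * (w - Complex.I))) := by
  rw [cayley_symm_coe]
  -- At `w = -i` the Blaschke product is evaluated at `∞`; elsewhere multiplication by `(w + i) ^ n`
  -- clears denominators.
  by_cases hw : w + Complex.I = 0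
  · have h2 : w - Complex.I ≠ 0 := by
      have : w - Complex.I = -(2 * Complex.I) := by linear_combination hw
      simp [this]
    have hp : (w - Complex.I) ^ n ≠ 0 := pow_ne_zero _ h2
    rw [hw, spherePoint, if_pos rfl, sphereMap_blaschkeRat_infty hc ha]
    refine spherePoint_eq_of_mul_eq hp one_ne_zero ?_ ?_
    · simp [mul_comm]
    · have : (w - Complex.I) ^ n = ∏ _k : Fin n, (w - Complex.I) := by simp
      rw [this, ← Finset.prod_mul_distrib, one_mul]
      exact Finset.prod_congr rfl fun k _ => by ring
  · have hp : (w + Complex.I) ^ n ≠ 0 := pow_ne_zero _ hw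
    have hpow : (w + Complex.I) ^ n = ∏ _k : Fin n, (w + Complex.I) := by simp
    rw [spherePoint, if_neg hw, sphereMap_blaschkeRat_coe hc ha]
    refine spherePoint_eq_of_mul_eq hp one_ne_zero ?_ ?_
    · rw [hpow, one_mul, mul_left_comm, ← Finset.prod_mul_distrib]
      congr 1
      exact Finset.prod_congr rfl fun k _ => by field_simp
    · rw [hpow, one_mul, ← Finset.prod_mul_distrib]
      exact Finset.prod_congr rfl fun k _ => by field_simp

end Blaschke

/-! ### Hermite–Biehler pairs: coefficients and coprimality -/

section HermiteBiehler

variable {n : ℕ}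

/-- `A + iD` is the monic polynomial with roots `α`, all of which lie in the upper half-plane. -/
def IsHermiteBiehler (A D : ℝ[X]) (α : Fin n → ℂ) : Prop :=
  (∀ k, 0 < (α k).im) ∧
    A.map Complex.ofRealHom + C Complex.I * D.map Complex.ofRealHom = ∏ k, (X - C (α k))

theorem exists_real_add_I_mul (E : ℂ[X]) :
    ∃ A D : ℝ[X], A.map Complex.ofRealHom + C Complex.I * D.map Complex.ofRealHom = E := by
  induction E using Polynomial.induction_on' with
  | add p q hp hq =>
    obtain ⟨A, D, rfl⟩ := hp
    obtain ⟨A', D', rfl⟩ := hq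
    refine ⟨A + A', D + D', ?_⟩
    simp only [Polynomial.map_add]
    ring
  | monomial m z =>
    refine ⟨monomial m z.re, monomial m z.im, ?_⟩
    simp only [map_monomial, C_mul_monomial, ← map_add]
    congr 1
    simpa [mul_comm] using Complex.re_add_im z

namespace IsHermiteBiehler

variable {A D : ℝ[X]} {α : Fin n → ℂ}

theorem conj_eq (h : IsHermiteBiehler A D α) :
    A.map Complex.ofRealHom - C Complex.I * D.map Complex.ofRealHom =
      ∏ k, (X - C (conj (α k))) := by
  have h1 := congrArg (Polynomial.map (starRingEnd ℂ)) h.2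
  have h2 : (starRingEnd ℂ).comp Complex.ofRealHom = Complex.ofRealHom := by ext; simp
  simpa [Polynomial.map_map, Polynomial.map_prod, h2, sub_eq_add_neg] using h1

theorem coeff_add (h : IsHermiteBiehler A D α) (m : ℕ) :
    (A.coeff m : ℂ) + Complex.I * D.coeff m = (∏ k, (X - C (α k))).coeff m := by
  simpa using congrArg (fun p => coeff p m) h.2

theorem coeff_left (h : IsHermiteBiehler A D α) (m : ℕ) :
    A.coeff m = ((∏ k, (X - C (α k))).coeff m).re := by
  rw [← h.coeff_add]; simp

theorem coeff_right (h : IsHermiteBiehler A D α) (m : ℕ) :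
    D.coeff m = ((∏ k, (X - C (α k))).coeff m).im := by
  rw [← h.coeff_add]; simp

theorem coeff_left_top (h : IsHermiteBiehler A D α) : A.coeff n = 1 := by
  rw [h.coeff_left, coeff_prod_X_sub_C, Complex.one_re]

theorem coeff_right_top (h : IsHermiteBiehler A D α) : D.coeff n = 0 := by
  rw [h.coeff_right, coeff_prod_X_sub_C, Complex.one_im]

theorem natDegree_left (h : IsHermiteBiehler A D α) : A.natDegree = n := by
  refine le_antisymm (natDegree_le_iff_coeff_eq_zero.mpr fun m hm => ?_)
    (le_natDegree_of_ne_zero (by simp [h.coeff_left_top]))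
  rw [h.coeff_left, coeff_eq_zero_of_natDegree_lt (by rwa [natDegree_prod_X_sub_C]),
    Complex.zero_re]

theorem monic_left (h : IsHermiteBiehler A D α) : A.Monic := by
  rw [Monic, leadingCoeff, h.natDegree_left, h.coeff_left_top]

theorem natDegree_right_le (h : IsHermiteBiehler A D α) : D.natDegree ≤ n - 1 := by
  refine natDegree_le_iff_coeff_eq_zero.mpr fun m hm => ?_
  rcases (show n ≤ m by omega).eq_or_lt with rfl | hm'
  · exact h.coeff_right_top
  · rw [h.coeff_right, coeff_eq_zero_of_natDegree_lt (by rwa [natDegree_prod_X_sub_C]),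
      Complex.zero_im]

theorem coeff_right_pred (h : IsHermiteBiehler A D α) (hn : 0 < n) :
    D.coeff (n - 1) = -∑ k, (α k).im := by
  have h1 := prod_X_sub_C_coeff_card_pred (Finset.univ : Finset (Fin n)) α (by simpa)
  rw [Finset.card_univ, Fintype.card_fin] at h1
  rw [h.coeff_right, h1, Complex.neg_im, Complex.im_sum]

/-- This fixes the degree of `D` and the sign of its leading coefficient, which later gives the
positive slope at infinity of `-A / D`. -/
theorem coeff_right_pred_neg (h : IsHermiteBiehler A D α) (hn : 0 < n) :
    D.coeff (n - 1) < 0 := by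
  have : Nonempty (Fin n) := ⟨⟨0, hn⟩⟩
  rw [h.coeff_right_pred hn, neg_lt_zero]
  exact Finset.sum_pos (fun k _ => h.1 k) Finset.univ_nonempty

theorem right_ne_zero (h : IsHermiteBiehler A D α) (hn : 0 < n) : D ≠ 0 := by
  rintro rfl
  simpa using h.coeff_right_pred_neg hn

theorem natDegree_right (h : IsHermiteBiehler A D α) (hn : 0 < n) : D.natDegree = n - 1 :=
  le_antisymm h.natDegree_right_le (le_natDegree_of_ne_zero (h.coeff_right_pred_neg hn).ne)

theorem eval_add (h : IsHermiteBiehler A D α) (w : ℂ) :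
    (A.map Complex.ofRealHom).eval w + Complex.I * (D.map Complex.ofRealHom).eval w =
      ∏ k, (w - α k) := by
  simpa [eval_prod] using congrArg (eval w) h.2

theorem eval_sub (h : IsHermiteBiehler A D α) (w : ℂ) :
    (A.map Complex.ofRealHom).eval w - Complex.I * (D.map Complex.ofRealHom).eval w =
      ∏ k, (w - conj (α k)) := by
  simpa [eval_prod] using congrArg (eval w) h.conj_eq

theorem isCoprime (h : IsHermiteBiehler A D α) :
    IsCoprime (A.map Complex.ofRealHom) (D.map Complex.ofRealHom) := by
  have h1 : IsCoprime (∏ k, (X - C (α k))) (∏ k, (X - C (conj (α k)))) := by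
    refine IsCoprime.prod_left fun i _ => IsCoprime.prod_right fun j _ => ?_
    refine isCoprime_X_sub_C_of_isUnit_sub (IsUnit.mk0 _ fun h2 => ?_)
    have h3 := congrArg Complex.im h2
    simp only [Complex.sub_im, Complex.conj_im, Complex.zero_im] at h3
    linarith [h.1 i, h.1 j]
  obtain ⟨u, v, huv⟩ := h1
  -- `A + iD` and `A - iD` have roots in opposite half-planes, and `u (A + iD) + v (A - iD) = (u +
  -- v) A + i (u - v) D`.
  refine ⟨u + v, C Complex.I * (u - v), ?_⟩
  rw [← h.2, ← h.conj_eq] at huv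
  rw [← huv]
  ring

end IsHermiteBiehler

/-! ### The conjugated Blaschke product in terms of `A` and `D` -/

theorem cayleyConj_infty (R : RatFunc ℂ) :
    cayleyConj (sphereMap R) ∞ = cayley (sphereMap R ((1 : ℂ) : OnePoint ℂ)) := rfl

/-- The parameters `a` and `α = T(a)` and the value `ε` of a Blaschke product at `1` match. -/
structure BlaschkeData (ε c : ℂ) (a α : Fin n → ℂ) : Prop where
  norm_eq : ‖c‖ = 1
  norm_lt : ∀ k, ‖a k‖ < 1
  cayley_eq : ∀ k, α k * (1 - a k) = Complex.I * (1 + a k)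
  value_eq : c * ∏ k, (1 - a k) = ε * ∏ k, (1 - conj (a k))

namespace BlaschkeData

variable {ε c : ℂ} {a α : Fin n → ℂ}

theorem coeff_ne_zero (h : BlaschkeData ε c a α) : c ≠ 0 := by
  intro hc
  simpa [hc] using h.norm_eq

theorem one_sub_ne_zero (h : BlaschkeData ε c a α) (k : Fin n) : 1 - a k ≠ 0 := by
  intro h1
  have := h.norm_lt k
  rw [← sub_eq_zero.mp h1] at this
  simp at this

theorem one_sub_conj_ne_zero (h : BlaschkeData ε c a α) (k : Fin n) : 1 - conj (a k) ≠ 0 := by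
  have := (map_ne_zero (starRingEnd ℂ)).mpr (h.one_sub_ne_zero k)
  simpa using this

theorem prod_one_sub_conj_ne_zero (h : BlaschkeData ε c a α) : ∏ k, (1 - conj (a k)) ≠ 0 :=
  Finset.prod_ne_zero_iff.mpr fun k _ => h.one_sub_conj_ne_zero k

theorem sphereMap_one (h : BlaschkeData ε c a α) :
    sphereMap (blaschkeRat c a) ((1 : ℂ) : OnePoint ℂ) = (ε : OnePoint ℂ) := by
  rw [sphereMap_blaschkeRat_coe h.coeff_ne_zero h.norm_lt, spherePoint_eq_coe_iff]
  simpa using ⟨h.prod_one_sub_conj_ne_zero, h.value_eq⟩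

/-- By `cayley_eq`, `(w - i) - a k (w + i) = (1 - a k) (w - α k)`, and conjugately for the
denominator; `value_eq` then turns the leftover constants into `ε`. -/
theorem sphereMap_cayley_symm (h : BlaschkeData ε c a α) (w : ℂ) :
    sphereMap (blaschkeRat c a) (cayley.symm (w : OnePoint ℂ)) =
      spherePoint (ε * ∏ k, (w - α k)) (∏ k, (w - conj (α k))) := by
  have hα : ∀ k, conj (α k) * (1 - conj (a k)) = -Complex.I * (1 + conj (a k)) := fun k => by
    simpa using congrArg conj (h.cayley_eq k)
  rw [sphereMap_blaschkeRat_cayley_symm h.coeff_ne_zero h.norm_lt]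
  refine spherePoint_eq_of_mul_eq one_ne_zero h.prod_one_sub_conj_ne_zero ?_ ?_
  · rw [one_mul, ← mul_assoc, mul_comm _ ε, ← h.value_eq, mul_assoc, ← Finset.prod_mul_distrib]
    congr 1
    exact Finset.prod_congr rfl fun k _ => by linear_combination h.cayley_eq k
  · rw [one_mul, ← Finset.prod_mul_distrib]
    exact Finset.prod_congr rfl fun k _ => by linear_combination hα k

theorem cayleyConj_coe (h : BlaschkeData ε c a α) {A D : ℝ[X]} (hAD : IsHermiteBiehler A D α)
    (hε : ε ≠ 0) (w : ℂ) :
    cayleyConj (sphereMap (blaschkeRat c a)) (w : OnePoint ℂ) =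
      spherePoint
        (Complex.I * (((A.map Complex.ofRealHom).eval w -
          Complex.I * (D.map Complex.ofRealHom).eval w) +
          ε * ((A.map Complex.ofRealHom).eval w + Complex.I * (D.map Complex.ofRealHom).eval w)))
        (((A.map Complex.ofRealHom).eval w - Complex.I * (D.map Complex.ofRealHom).eval w) -
          ε * ((A.map Complex.ofRealHom).eval w +
            Complex.I * (D.map Complex.ofRealHom).eval w)) := by
  rw [cayleyConj, Function.comp_apply, Function.comp_apply, h.sphereMap_cayley_symm,
    cayley_spherePoint, hAD.eval_add, hAD.eval_sub]
  -- The point is not `[0 : 0]`: otherwise `A` and `D` would both vanish at `w`, contradicting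
  -- coprimality.
  by_contra! h0
  have h1 := (mul_eq_zero.mp h0.1).resolve_left hε
  obtain ⟨u, v, huv⟩ := hAD.isCoprime
  have h2 := congrArg (eval w) huv
  rw [eval_add, eval_mul, eval_mul, eval_one] at h2
  rw [← hAD.eval_add] at h1
  have h3 := h0.2
  rw [← hAD.eval_sub] at h3
  have h4 : (A.map Complex.ofRealHom).eval w = 0 := by linear_combination (h1 + h3) / 2
  have h5 : (D.map Complex.ofRealHom).eval w = 0 := by
    rw [h4] at h1
    simpa using h1
  simp [h4, h5] at h2

theorem cayleyConj_neg_one (h : BlaschkeData (-1) c a α) {A D : ℝ[X]}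
    (hAD : IsHermiteBiehler A D α) :
    cayleyConj (sphereMap (blaschkeRat c a)) =
      sphereMap (algebraMap ℂ[X] (RatFunc ℂ) (D.map Complex.ofRealHom) /
        algebraMap ℂ[X] (RatFunc ℂ) (A.map Complex.ofRealHom)) := by
  have hA : A.map Complex.ofRealHom ≠ 0 := (hAD.monic_left.map _).ne_zero
  funext w
  induction w using OnePoint.rec with
  | infty =>
    rw [cayleyConj_infty, h.sphereMap_one, sphereMap_div_infty (n := n) hAD.isCoprime.symm hA
      (by rw [natDegree_map]; exact hAD.natDegree_right_le.trans (Nat.sub_le _ _))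
      (by rw [natDegree_map, hAD.natDegree_left])
      (by simp [hAD.coeff_left_top])]
    simp [hAD.coeff_left_top, hAD.coeff_right_top, spherePoint, cayley, cayleyFun]
    norm_num
  | coe w =>
    rw [h.cayleyConj_coe hAD (by simp), sphereMap_div_coe hAD.isCoprime.symm hA]
    refine spherePoint_eq_of_mul_eq one_ne_zero two_ne_zero ?_ ?_
    · linear_combination (-2 * (D.map Complex.ofRealHom).eval w) * Complex.I_sq
    · ring

theorem cayleyConj_one (h : BlaschkeData 1 c a α) {A D : ℝ[X]}
    (hAD : IsHermiteBiehler A D α) (hn : 0 < n) :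
    cayleyConj (sphereMap (blaschkeRat c a)) =
      sphereMap (algebraMap ℂ[X] (RatFunc ℂ) (-A.map Complex.ofRealHom) /
        algebraMap ℂ[X] (RatFunc ℂ) (D.map Complex.ofRealHom)) := by
  have hD : D.map Complex.ofRealHom ≠ 0 := by
    rw [Polynomial.map_ne_zero_iff Complex.ofReal_injective]
    exact hAD.right_ne_zero hn
  funext w
  induction w using OnePoint.rec with
  | infty =>
    rw [cayleyConj_infty, h.sphereMap_one, sphereMap_div_infty (n := n) hAD.isCoprime.neg_left hD
      (by rw [natDegree_neg, natDegree_map, hAD.natDegree_left])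
      (by rw [natDegree_map]; exact hAD.natDegree_right_le.trans (Nat.sub_le _ _))
      (by simp [hAD.coeff_left_top])]
    simp [hAD.coeff_right_top, spherePoint, cayley, cayleyFun]
  | coe w =>
    rw [h.cayleyConj_coe hAD one_ne_zero, sphereMap_div_coe hAD.isCoprime.neg_left hD, eval_neg]
    refine spherePoint_eq_of_mul_eq one_ne_zero
      (show -2 * Complex.I ≠ 0 by simp) ?_ ?_
    · ring
    · ring

end BlaschkeData

theorem im_pos_of_cayley {a α : ℂ} (ha : ‖a‖ < 1) (h : α * (1 - a) = Complex.I * (1 + a)) :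
    0 < α.im := by
  have h1 : ‖(α - Complex.I)‖ < ‖α + Complex.I‖ := by
    -- Equivalently `a = (α - i) / (α + i)`, so `‖a‖ < 1` says that `α` is nearer to `i` than to
    -- `-i`.
    have h2 : α - Complex.I = a * (α + Complex.I) := by linear_combination h
    have h3 : α + Complex.I ≠ 0 := by
      intro h3
      have h4 : α - Complex.I = 0 := by rw [h2, h3, mul_zero]
      have h5 : (2 : ℂ) * Complex.I = 0 := by linear_combination h3 - h4
      simp at h5
    rw [h2, norm_mul]
    exact mul_lt_of_lt_one_left (norm_pos_iff.mpr h3) ha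
  rw [← sq_lt_sq₀ (norm_nonneg _) (norm_nonneg _), Complex.sq_norm, Complex.sq_norm,
    Complex.normSq_apply, Complex.normSq_apply] at h1
  simp at h1
  nlinarith

theorem BlaschkeData.im_pos {ε c : ℂ} {a α : Fin n → ℂ} (h : BlaschkeData ε c a α) (k : Fin n) :
    0 < (α k).im :=
  im_pos_of_cayley (h.norm_lt k) (h.cayley_eq k)

theorem BlaschkeData.exists_isHermiteBiehler {ε c : ℂ} {a α : Fin n → ℂ}
    (h : BlaschkeData ε c a α) : ∃ A D : ℝ[X], IsHermiteBiehler A D α := by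
  obtain ⟨A, D, hAD⟩ := exists_real_add_I_mul (∏ k, (X - C (α k)))
  exact ⟨A, D, h.im_pos, hAD⟩

theorem exists_blaschkeData_of_value {ε : ℂ} {B : OnePoint ℂ → OnePoint ℂ}
    (hB : IsBlaschkeProduct n B) (h1 : B ((1 : ℂ) : OnePoint ℂ) = (ε : OnePoint ℂ)) :
    ∃ (c : ℂ) (a α : Fin n → ℂ), BlaschkeData ε c a α ∧ B = sphereMap (blaschkeRat c a) := by
  obtain ⟨c, a, hc, ha, rfl⟩ := hB
  have hc0 : c ≠ 0 := by
    rintro rfl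
    simp at hc
  rw [sphereMap_blaschkeRat_coe hc0 ha, spherePoint_eq_coe_iff] at h1
  refine ⟨c, a, fun k => Complex.I * (1 + a k) / (1 - a k), ⟨hc, ha, fun k => ?_, ?_⟩, rfl⟩
  · refine div_mul_cancel₀ _ fun h2 => ?_
    have h3 := ha k
    rw [← sub_eq_zero.mp h2] at h3
    simp at h3
  · simpa using h1.2

theorem exists_blaschkeData_of_im_pos {ε : ℂ} (hε : ‖ε‖ = 1) {α : Fin n → ℂ}
    (hα : ∀ k, 0 < (α k).im) : ∃ (c : ℂ) (a : Fin n → ℂ), BlaschkeData ε c a α := by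
  have h1 : ∀ k, α k + Complex.I ≠ 0 := fun k h => by
    have := congrArg Complex.im h
    simp at this
    linarith [hα k]
  have h2 : ∀ k, 1 - (α k - Complex.I) / (α k + Complex.I) =
      2 * Complex.I / (α k + Complex.I) := fun k => by
    rw [eq_div_iff (h1 k), sub_mul, div_mul_cancel₀ _ (h1 k)]
    ring
  set a : Fin n → ℂ := fun k => (α k - Complex.I) / (α k + Complex.I) with ha
  have h3 : ∀ k, 1 - a k ≠ 0 := fun k => by
    rw [ha]
    simp only [h2]
    exact div_ne_zero (by simp) (h1 k)
  have h4 : ∏ k, (1 - a k) ≠ 0 := Finset.prod_ne_zero_iff.mpr fun k _ => h3 k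
  have h5 : ∏ k, (1 - conj (a k)) = conj (∏ k, (1 - a k)) := by simp
  -- The constant `c` is forced by the value at `1`; it is unimodular because the two products are
  -- conjugate.
  refine ⟨ε * (∏ k, (1 - conj (a k))) / ∏ k, (1 - a k), a, ?_, fun k => ?_, fun k => ?_, ?_⟩
  · rw [h5, norm_div, norm_mul, hε, one_mul, Complex.norm_conj, div_self (norm_ne_zero_iff.mpr h4)]
  · rw [ha]
    simp only [norm_div]
    rw [div_lt_one (norm_pos_iff.mpr (h1 k)), ← sq_lt_sq₀ (norm_nonneg _) (norm_nonneg _),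
      Complex.sq_norm, Complex.sq_norm, Complex.normSq_apply, Complex.normSq_apply]
    simp
    nlinarith [hα k]
  · rw [ha]
    simp only [h2]
    field_simp [h1 k]
    ring
  · exact div_mul_cancel₀ _ h4

end HermiteBiehler

/-! ### Reality and simplicity of the roots of `A` and `D` -/

theorem degree_C_mul_le {R : Type*} [Semiring R] (a : R) (p : R[X]) :
    (C a * p).degree ≤ p.degree := by
  rw [← smul_eq_C_mul]
  exact degree_smul_le a p

theorem norm_sub_lt_norm_sub_conj {w α : ℂ} (hw : 0 < w.im) (hα : 0 < α.im) :
    ‖w - α‖ < ‖w - conj α‖ := by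
  rw [← sq_lt_sq₀ (norm_nonneg _) (norm_nonneg _), Complex.sq_norm, Complex.sq_norm,
    Complex.normSq_apply, Complex.normSq_apply]
  simp
  nlinarith [mul_pos hw hα]

section HermiteBiehler

variable {n : ℕ} {A D : ℝ[X]} {α : Fin n → ℂ}

namespace IsHermiteBiehler

theorem prod_sub_ne_zero_or (h : IsHermiteBiehler A D α) (w : ℂ) :
    ∏ k, (w - α k) ≠ 0 ∨ ∏ k, (w - conj (α k)) ≠ 0 := by
  by_contra! h0
  obtain ⟨i, -, hi⟩ := Finset.prod_eq_zero_iff.mp h0.1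
  obtain ⟨j, -, hj⟩ := Finset.prod_eq_zero_iff.mp h0.2
  have h1 := congrArg Complex.im (sub_eq_zero.mp hi)
  have h2 := congrArg Complex.im (sub_eq_zero.mp hj)
  rw [Complex.conj_im] at h2
  linarith [h.1 i, h.1 j]

/-- Off the real axis, `w` is strictly nearer to one point of each pair `α k`, `conj (α k)`, always
the one on its own side, so the two products differ in modulus. At a root of `A` or of `D` the
moduli agree. -/
theorem im_eq_zero_of_norm_eq (h : IsHermiteBiehler A D α) (hn : 0 < n) {w : ℂ}
    (hw : ‖∏ k, (w - α k)‖ = ‖∏ k, (w - conj (α k))‖) : w.im = 0 := by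
  have : Nonempty (Fin n) := ⟨⟨0, hn⟩⟩
  have h1 : ∏ k, (w - α k) ≠ 0 := by
    rcases h.prod_sub_ne_zero_or w with h1 | h1
    · exact h1
    · rwa [← norm_ne_zero_iff, hw, norm_ne_zero_iff]
  have h2 : ∏ k, (w - conj (α k)) ≠ 0 := by rwa [← norm_ne_zero_iff, ← hw, norm_ne_zero_iff]
  rw [Finset.prod_ne_zero_iff] at h1 h2
  rw [norm_prod, norm_prod] at hw
  rcases lt_trichotomy w.im 0 with hlt | heq | hgt
  · refine absurd hw (ne_of_gt ?_)
    refine Finset.prod_lt_prod_of_nonempty (fun k hk => norm_pos_iff.mpr (h2 k hk)) (fun k _ => ?_)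
      Finset.univ_nonempty
    have h3 := norm_sub_lt_norm_sub_conj (w := conj w) (by simpa using hlt) (h.1 k)
    rwa [← Complex.norm_conj, ← Complex.norm_conj (conj w - conj (α k)), map_sub, map_sub,
      Complex.conj_conj, Complex.conj_conj] at h3
  · exact heq
  · refine absurd hw (ne_of_lt ?_)
    exact Finset.prod_lt_prod_of_nonempty (fun k hk => norm_pos_iff.mpr (h1 k hk))
      (fun k _ => norm_sub_lt_norm_sub_conj hgt (h.1 k)) Finset.univ_nonempty

theorem im_eq_zero_of_left_root (h : IsHermiteBiehler A D α) (hn : 0 < n) {w : ℂ}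
    (hw : (A.map Complex.ofRealHom).eval w = 0) : w.im = 0 := by
  refine h.im_eq_zero_of_norm_eq hn ?_
  rw [← h.eval_add, ← h.eval_sub, hw, zero_add, zero_sub, norm_neg]

theorem im_eq_zero_of_right_root (h : IsHermiteBiehler A D α) (hn : 0 < n) {w : ℂ}
    (hw : (D.map Complex.ofRealHom).eval w = 0) : w.im = 0 := by
  refine h.im_eq_zero_of_norm_eq hn ?_
  rw [← h.eval_add, ← h.eval_sub, hw, mul_zero, add_zero, sub_zero]

/-- With `E = A + iD`, the Wronskian is `Im (E' conj E) = |E|² Im (E' / E)` on the real line. Here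
`E' / E = ∑ 1 / (x - α k)`, and every term has positive imaginary part. -/
theorem wronskian_pos (h : IsHermiteBiehler A D α) (hn : 0 < n) (x : ℝ) :
    0 < (derivative D).eval x * A.eval x - (derivative A).eval x * D.eval x := by
  have : Nonempty (Fin n) := ⟨⟨0, hn⟩⟩
  have hne : ∀ k, (x : ℂ) - α k ≠ 0 := fun k hk => by
    have := congrArg Complex.im hk
    simp at this
    linarith [h.1 k]
  have hE : ∏ k, ((x : ℂ) - α k) ≠ 0 := Finset.prod_ne_zero_iff.mpr fun k _ => hne k
  have e1 : ((A.eval x : ℝ) : ℂ) + Complex.I * (D.eval x : ℝ) = ∏ k, ((x : ℂ) - α k) := by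
    have := h.eval_add (x : ℂ)
    rwa [← Complex.ofRealHom_eq_coe, eval_map_apply, eval_map_apply] at this
  have e2 : (((derivative A).eval x : ℝ) : ℂ) + Complex.I * ((derivative D).eval x : ℝ) =
      (∏ k, ((x : ℂ) - α k)) * ∑ k, ((x : ℂ) - α k)⁻¹ := by
    have h1 := congrArg (fun p => eval (x : ℂ) (derivative p)) h.2
    simp only [derivative_add, derivative_C_mul, derivative_map, Polynomial.eval_add,
      eval_mul, eval_C] at h1
    rw [← Complex.ofRealHom_eq_coe, eval_map_apply, eval_map_apply] at h1
    simp only [Complex.ofRealHom_eq_coe] at h1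
    rw [h1, derivative_prod_finset, eval_finsetSum, Finset.mul_sum]
    refine Finset.sum_congr rfl fun k hk => ?_
    rw [← Finset.mul_prod_erase _ _ hk, mul_comm, mul_comm (_ - _), mul_assoc,
      mul_inv_cancel₀ (hne k)]
    simp [eval_prod]
  have e3 : (derivative D).eval x * A.eval x - (derivative A).eval x * D.eval x =
      Complex.normSq (∏ k, ((x : ℂ) - α k)) * (∑ k, ((x : ℂ) - α k)⁻¹).im := by
    have h1 : (derivative D).eval x * A.eval x - (derivative A).eval x * D.eval x =
        (((((derivative A).eval x : ℝ) : ℂ) + Complex.I * ((derivative D).eval x : ℝ)) *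
          conj (((A.eval x : ℝ) : ℂ) + Complex.I * (D.eval x : ℝ))).im := by
      simp
      ring
    rw [h1, e1, e2, mul_right_comm, Complex.mul_conj, Complex.im_ofReal_mul]
  rw [e3]
  refine mul_pos (Complex.normSq_pos.mpr hE) ?_
  rw [Complex.im_sum]
  refine Finset.sum_pos (fun k _ => ?_) Finset.univ_nonempty
  rw [Complex.inv_im]
  refine div_pos ?_ (Complex.normSq_pos.mpr (hne k))
  simpa using h.1 k

end IsHermiteBiehler

end HermiteBiehler

/-! ### Factorization into linear factors -/

/-- A real polynomial whose complex roots are real and simple is a product of distinct linear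
factors. -/
theorem exists_strictMono_eq_prod {F : ℝ[X]} {m : ℕ} (hdeg : F.natDegree = m) (hF : F ≠ 0)
    (hreal : ∀ w : ℂ, (F.map Complex.ofRealHom).eval w = 0 → w.im = 0)
    (hsimple : ∀ x : ℝ, F.eval x = 0 → (derivative F).eval x ≠ 0) :
    ∃ x : Fin m → ℝ, StrictMono x ∧ F = C F.leadingCoeff * ∏ k, (X - C (x k)) := by
  have hsplit : F.Splits := by
    refine Splits.of_splits_map_of_injective (i := Complex.ofRealHom) Complex.ofReal_injective
      (IsAlgClosed.splits _) fun w hw => ?_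
    have h1 := hreal w (isRoot_of_mem_roots hw)
    exact ⟨w.re, Complex.ext (by simp) (by simp [h1])⟩
  have hnodup : F.roots.Nodup := by
    rw [Multiset.nodup_iff_count_le_one]
    intro x
    rw [count_roots]
    by_contra! h1
    have h2 := (one_lt_rootMultiplicity_iff_isRoot hF).mp h1
    exact hsimple x h2.1 h2.2
  have hcard : F.roots.toFinset.card = m := by
    rw [Multiset.toFinset_card_of_nodup hnodup, ← hdeg, hsplit.natDegree_eq_card_roots]
  refine ⟨F.roots.toFinset.orderEmbOfFin hcard, OrderEmbedding.strictMono _, ?_⟩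
  conv_lhs => rw [hsplit.eq_prod_roots]
  congr 1
  have h1 : ∏ k, (X - C (F.roots.toFinset.orderEmbOfFin hcard k)) =
      ∏ t ∈ F.roots.toFinset, (X - C t) := by
    conv_rhs => rw [← Finset.image_orderEmbOfFin_univ F.roots.toFinset hcard]
    rw [Finset.prod_image fun _ _ _ _ h => (F.roots.toFinset.orderEmbOfFin hcard).injective h]
  rw [h1, Finset.prod, Multiset.toFinset_val, Multiset.dedup_eq_self.mpr hnodup]

theorem exists_eq_prod_X_sub_C {E : ℂ[X]} {n : ℕ} (hE : E.Monic) (hn : E.natDegree = n) :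
    ∃ α : Fin n → ℂ, E = ∏ k, (X - C (α k)) := by
  have hs : E.Splits := IsAlgClosed.splits E
  have hl : E.roots.toList.length = n := by
    rw [Multiset.length_toList, ← hs.natDegree_eq_card_roots, hn]
  subst hl
  refine ⟨E.roots.toList.get, ?_⟩
  conv_lhs => rw [hs.eq_prod_roots_of_monic hE, ← Multiset.coe_toList E.roots]
  rw [Multiset.map_coe, Multiset.prod_coe, ← List.prod_ofFn]
  congr 1
  exact (List.ofFn_getElem_eq_map ..).symm

/-! ### Partial fractions with real simple poles -/

section PartialFractions

variable {m : ℕ}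

/-- The numerator of `∑ rₖ / (X - xₖ)` over the denominator `∏ (X - xₖ)`. -/
noncomputable def partialFractionsNum (r x : Fin m → ℝ) : ℝ[X] :=
  ∑ k, C (r k) * ∏ j ∈ Finset.univ.erase k, (X - C (x j))

theorem map_prod_X_sub_C (x : Fin m → ℝ) :
    (∏ k, (X - C (x k))).map Complex.ofRealHom = ∏ k, (X - C (x k : ℂ)) := by
  simp [Polynomial.map_prod]

theorem algebraMap_prod_X_sub_C_ne_zero (x : Fin m → ℝ) :
    algebraMap ℂ[X] (RatFunc ℂ) ((∏ k, (X - C (x k))).map Complex.ofRealHom) ≠ 0 := by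
  refine RatFunc.algebraMap_ne_zero ?_
  rw [map_prod_X_sub_C]
  exact (monic_prod_X_sub_C _ _).ne_zero

theorem partialFractions_eq_div (r x : Fin m → ℝ) :
    partialFractions r x =
      algebraMap ℂ[X] (RatFunc ℂ) ((partialFractionsNum r x).map Complex.ofRealHom) /
        algebraMap ℂ[X] (RatFunc ℂ) ((∏ k, (X - C (x k))).map Complex.ofRealHom) := by
  rw [eq_div_iff (algebraMap_prod_X_sub_C_ne_zero x), partialFractions, partialFractionsNum,
    map_prod_X_sub_C, Finset.sum_mul, Polynomial.map_sum, map_sum]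
  refine Finset.sum_congr rfl fun k hk => ?_
  have h : (RatFunc.X - RatFunc.C (x k : ℂ)) ≠ 0 := by
    have := RatFunc.algebraMap_ne_zero (X_sub_C_ne_zero (x k : ℂ))
    simpa using this
  rw [← Finset.mul_prod_erase _ _ hk, map_mul, map_sub, RatFunc.algebraMap_X, RatFunc.algebraMap_C,
    ← mul_assoc, div_mul_cancel₀ _ h]
  simp [Polynomial.map_prod]

theorem degree_partialFractionsNum_lt (r x : Fin m → ℝ) :
    (partialFractionsNum r x).degree < m := by
  refine (degree_sum_le _ _).trans_lt ((Finset.sup_lt_iff (WithBot.bot_lt_coe m)).mpr ?_)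
  intro k hk
  refine (degree_C_mul_le _ _).trans_lt ?_
  rw [degree_prod]
  simp only [degree_X_sub_C, Finset.sum_const, Finset.card_erase_of_mem hk, Finset.card_univ,
    Fintype.card_fin, nsmul_eq_mul, mul_one]
  exact WithBot.coe_lt_coe.mpr (Nat.sub_lt (Fin.pos k) one_pos)

theorem eval_partialFractionsNum_node (r x : Fin m → ℝ) (k : Fin m) :
    (partialFractionsNum r x).eval (x k) =
      r k * (derivative (∏ j, (X - C (x j)))).eval (x k) := by
  have h1 : ∀ i, (∏ j ∈ Finset.univ.erase i, (X - C (x j))).eval (x k) =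
      if i = k then ∏ j ∈ Finset.univ.erase k, (x k - x j) else 0 := fun i => by
    split_ifs with h
    · subst h
      simp [eval_prod]
    · rw [eval_prod]
      exact Finset.prod_eq_zero (Finset.mem_erase.mpr ⟨Ne.symm h, Finset.mem_univ k⟩) (by simp)
  simp [partialFractionsNum, derivative_prod_finset, eval_finsetSum, h1]

/-- Lagrange interpolation: a polynomial of degree below `m` is determined by its values at `m`
distinct nodes. -/
theorem eq_partialFractionsNum {N : ℝ[X]} {r x : Fin m → ℝ} (hx : Function.Injective x)
    (hN : N.degree < m)
    (h : ∀ k, N.eval (x k) = r k * (derivative (∏ j, (X - C (x j)))).eval (x k)) :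
    N = partialFractionsNum r x := by
  refine eq_of_degrees_lt_of_eval_index_eq (s := Finset.univ) (v := x) hx.injOn (by simpa)
    (by simpa using degree_partialFractionsNum_lt r x) fun k _ => ?_
  rw [h, eval_partialFractionsNum_node]

theorem eval_map_partialFractionsNum (r x : Fin m → ℝ) {z : ℂ} (hz : ∀ k, z - x k ≠ 0) :
    ((partialFractionsNum r x).map Complex.ofRealHom).eval z =
      ((∏ j, (X - C (x j))).map Complex.ofRealHom).eval z * ∑ k, (r k : ℂ) * (z - x k)⁻¹ := by
  rw [map_prod_X_sub_C, partialFractionsNum, Polynomial.map_sum, eval_finsetSum, Finset.mul_sum]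
  refine Finset.sum_congr rfl fun k hk => ?_
  rw [← Finset.mul_prod_erase _ _ hk, eval_mul]
  have h1 : eval z (X - C (x k : ℂ)) = z - x k := by simp
  simp only [h1, Polynomial.map_mul, Polynomial.map_prod, Polynomial.map_sub, map_X, map_C, eval_mul,
    eval_C, Complex.ofRealHom_eq_coe]
  field_simp [hz k]

/-- For `Im z ≤ 0` every term on the left has imaginary part at most `0`, while `i` has imaginary
part `1`. Allowing `a = 0` lets both families use the same statement. -/
theorem im_pos_of_partialFractions {a b : ℝ} {s t : Fin m → ℝ} (ha : 0 ≤ a) (hs : ∀ k, 0 < s k)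
    {z : ℂ} (h : a * z + b - ∑ k, (s k : ℂ) * (z - t k)⁻¹ = Complex.I) : 0 < z.im := by
  by_contra! hz
  have h1 := congrArg Complex.im h
  simp only [Complex.sub_im, Complex.add_im, Complex.im_ofReal_mul, Complex.ofReal_im,
    Complex.im_sum, Complex.inv_im, Complex.I_im, add_zero, sub_zero] at h1
  have h2 : 0 ≤ ∑ k, s k * (-z.im / Complex.normSq (z - t k)) :=
    Finset.sum_nonneg fun k _ => mul_nonneg (hs k).le
      (div_nonneg (by linarith) (Complex.normSq_nonneg _))
  have h3 : a * z.im ≤ 0 := mul_nonpos_of_nonneg_of_nonpos ha hz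
  linarith

end PartialFractions

/-! ### Passing between Hermite–Biehler pairs and partial fractions -/

theorem cayleyConj_injective : Function.Injective cayleyConj := by
  intro B B' h
  funext z
  have h1 := congrFun h (cayley z)
  simpa [cayleyConj] using h1

section

variable {n : ℕ} {A D : ℝ[X]} {α : Fin n → ℂ}

theorem neg_partialFractions (r x : Fin n → ℝ) :
    -partialFractions r x = partialFractions (-r) x := by
  rw [partialFractions, partialFractions, ← Finset.sum_neg_distrib]
  refine Finset.sum_congr rfl fun k _ => ?_
  rw [Pi.neg_apply, Complex.ofReal_neg, map_neg]
  exact (neg_div _ _).symm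

namespace IsHermiteBiehler

theorem exists_partialFractions_right_div_left (h : IsHermiteBiehler A D α) (hn : 0 < n) :
    ∃ r x : Fin n → ℝ, StrictMono x ∧ (∀ k, 0 < r k) ∧
      algebraMap ℂ[X] (RatFunc ℂ) (D.map Complex.ofRealHom) /
        algebraMap ℂ[X] (RatFunc ℂ) (A.map Complex.ofRealHom) = -partialFractions r x := by
  have hW := h.wronskian_pos hn
  have hsimple : ∀ x : ℝ, A.eval x = 0 → (derivative A).eval x ≠ 0 := fun x hx h0 => by
    have := hW x
    simp [hx, h0] at this
  obtain ⟨x, hx, hA⟩ := exists_strictMono_eq_prod h.natDegree_left h.monic_left.ne_zero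
    (fun w hw => h.im_eq_zero_of_left_root hn hw) hsimple
  rw [h.monic_left.leadingCoeff, C_1, one_mul] at hA
  have hroot : ∀ k, A.eval (x k) = 0 := fun k => by
    rw [hA, eval_prod]
    exact Finset.prod_eq_zero (Finset.mem_univ k) (by simp)
  have hD : D = partialFractionsNum (fun k => D.eval (x k) / (derivative A).eval (x k)) x := by
    refine eq_partialFractionsNum hx.injective ?_ fun k => ?_
    · refine (degree_lt_iff_coeff_zero _ _).mpr fun m hm => ?_
      exact coeff_eq_zero_of_natDegree_lt (h.natDegree_right_le.trans_lt (by omega))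
    · rw [← hA, div_mul_cancel₀ _ (hsimple _ (hroot k))]
  refine ⟨fun k => -(D.eval (x k) / (derivative A).eval (x k)), x, hx, fun k => ?_, ?_⟩
  · have h1 := hW (x k)
    -- At a root of `A` the Wronskian is `-A'D`, so `A'` and `D` have opposite signs and the residue
    -- `D / A'` is negative.
    rw [hroot k, mul_zero, zero_sub, neg_pos] at h1
    rw [neg_pos, div_neg_iff]
    rcases mul_neg_iff.mp h1 with h2 | h2
    · exact Or.inr ⟨h2.2, h2.1⟩
    · exact Or.inl ⟨h2.2, h2.1⟩
  · rw [neg_partialFractions, partialFractions_eq_div, ← hA]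
    congr 3
    conv_lhs => rw [hD]
    congr 1
    funext k
    simp

theorem exists_partialFractions_neg_left_div_right {m : ℕ} {α : Fin (m + 1) → ℂ}
    (h : IsHermiteBiehler A D α) :
    ∃ (a b : ℝ) (s t : Fin m → ℝ), 0 < a ∧ StrictMono t ∧ (∀ k, 0 < s k) ∧
      algebraMap ℂ[X] (RatFunc ℂ) (-A.map Complex.ofRealHom) /
        algebraMap ℂ[X] (RatFunc ℂ) (D.map Complex.ofRealHom) =
      RatFunc.C (a : ℂ) * RatFunc.X + RatFunc.C (b : ℂ) - partialFractions s t := by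
  have hn : 0 < m + 1 := Nat.succ_pos m
  have hW := h.wronskian_pos hn
  have hsimple : ∀ x : ℝ, D.eval x = 0 → (derivative D).eval x ≠ 0 := fun x hx h0 => by
    have := hW x
    simp [hx, h0] at this
  have hdeg : D.natDegree = m := h.natDegree_right hn
  obtain ⟨t, ht, hD⟩ := exists_strictMono_eq_prod hdeg (h.right_ne_zero hn)
    (fun w hw => h.im_eq_zero_of_right_root hn hw) hsimple
  have hκ : D.leadingCoeff < 0 := by
    rw [leadingCoeff, hdeg]
    exact h.coeff_right_pred_neg hn
  set κ := D.leadingCoeff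
  set F : ℝ[X] := ∏ k, (X - C (t k)) with hF
  have hFmonic : F.Monic := monic_prod_X_sub_C _ _
  have hFdeg : F.natDegree = m := by simp [hF]
  have hFroot : ∀ k, F.eval (t k) = 0 := fun k => by
    rw [hF, eval_prod]
    exact Finset.prod_eq_zero (Finset.mem_univ k) (by simp)
  have hDroot : ∀ k, D.eval (t k) = 0 := fun k => by rw [hD, eval_mul, hFroot, mul_zero]
  have hD' : ∀ k, (derivative D).eval (t k) = κ * (derivative F).eval (t k) := fun k => by
    rw [hD, derivative_C_mul, eval_mul, eval_C]
  have hdiv := modByMonic_add_div A F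
  -- `A` and `F` are monic with degrees `m + 1` and `m`, so the quotient is monic and linear.
  have hq : A /ₘ F = X + C ((A /ₘ F).coeff 0) := by
    refine Monic.eq_X_add_C ?_ ?_
    · rw [Monic, leadingCoeff_divByMonic_of_monic hFmonic, h.monic_left.leadingCoeff]
      rw [degree_eq_natDegree hFmonic.ne_zero, degree_eq_natDegree h.monic_left.ne_zero, hFdeg,
        h.natDegree_left]
      exact_mod_cast Nat.le_succ m
    · rw [natDegree_divByMonic A hFmonic, hFdeg, h.natDegree_left, Nat.add_sub_cancel_left]
  set b₀ := (A /ₘ F).coeff 0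
  have hs : ∀ k, (A %ₘ F).eval (t k) =
      (A.eval (t k) / (derivative F).eval (t k)) * (derivative F).eval (t k) := fun k => by
    have h1 : (derivative F).eval (t k) ≠ 0 := fun h0 =>
      hsimple _ (hDroot k) (by rw [hD', h0, mul_zero])
    rw [div_mul_cancel₀ _ h1]
    conv_rhs => rw [← hdiv, Polynomial.eval_add, eval_mul, hFroot, zero_mul, add_zero]
  have hN := eq_partialFractionsNum ht.injective (by
    rw [← hFdeg, ← degree_eq_natDegree hFmonic.ne_zero]
    exact degree_modByMonic_lt A hFmonic) hs
  -- These come from dividing `A = (X + b₀) F + N` by `-D = -κ F`, where `N / F` has residue `A /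
  -- F'` at each `t k`.
  refine ⟨-κ⁻¹, -κ⁻¹ * b₀, fun k => κ⁻¹ * (A.eval (t k) / (derivative F).eval (t k)), t,
    neg_pos.mpr (inv_lt_zero.mpr hκ), ht, fun k => ?_, ?_⟩
  · have h1 := hW (t k)
    rw [hDroot k, mul_zero, sub_zero, hD'] at h1
    have h2 : κ⁻¹ * (A.eval (t k) / (derivative F).eval (t k)) =
        A.eval (t k) / (κ * (derivative F).eval (t k)) := by
      rw [div_eq_mul_inv, div_eq_mul_inv, mul_inv]
      ring
    change 0 < κ⁻¹ * (A.eval (t k) / (derivative F).eval (t k))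
    rw [h2, div_pos_iff]
    rcases mul_pos_iff.mp h1 with h3 | h3
    · exact Or.inl h3.symm
    · exact Or.inr h3.symm
  · have hpf : partialFractions
        (fun k => κ⁻¹ * (A.eval (t k) / (derivative F).eval (t k))) t = RatFunc.C (κ⁻¹ : ℂ) *
        partialFractions (fun k => A.eval (t k) / (derivative F).eval (t k)) t := by
      rw [partialFractions, partialFractions, Finset.mul_sum]
      refine Finset.sum_congr rfl fun k _ => ?_
      rw [Complex.ofReal_mul, Complex.ofReal_inv, map_mul, mul_div_assoc]
    have hF0 := algebraMap_prod_X_sub_C_ne_zero t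
    have hκ0 : RatFunc.C (κ : ℂ) ≠ 0 := by
      rw [_root_.map_ne_zero]
      exact_mod_cast hκ.ne
    have hA : A = (X + C b₀) * F +
        partialFractionsNum (fun k => A.eval (t k) / (derivative F).eval (t k)) t := by
      conv_lhs => rw [← hdiv, hN, hq]
      ring
    rw [hpf, partialFractions_eq_div, hD]
    have hA2 := congrArg
      (fun p : ℝ[X] => algebraMap ℂ[X] (RatFunc ℂ) (p.map Complex.ofRealHom)) hA
    simp only [Polynomial.map_add, Polynomial.map_mul, map_add, map_mul, map_X, map_C,
      RatFunc.algebraMap_X, RatFunc.algebraMap_C, Complex.ofRealHom_eq_coe] at hA2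
    simp only [Polynomial.map_mul, map_mul, map_C, RatFunc.algebraMap_C, map_neg,
      Complex.ofRealHom_eq_coe, Complex.ofReal_neg, Complex.ofReal_mul, Complex.ofReal_inv,
      map_inv₀]
    rw [hA2]
    rw [← hF] at hF0 ⊢
    field_simp
    ring

end IsHermiteBiehler

theorem isHermiteBiehler_of_roots {A D : ℝ[X]} (hA : A.Monic) (hAn : A.natDegree = n)
    (hD : D.degree < n)
    (h : ∀ w : ℂ, (A.map Complex.ofRealHom).eval w +
      Complex.I * (D.map Complex.ofRealHom).eval w = 0 → 0 < w.im) :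
    ∃ α : Fin n → ℂ, IsHermiteBiehler A D α := by
  have hdeg : (C Complex.I * D.map Complex.ofRealHom).degree <
      (A.map Complex.ofRealHom).degree := by
    refine (degree_C_mul_le _ _).trans_lt ?_
    rw [degree_map, degree_map, degree_eq_natDegree hA.ne_zero, hAn]
    exact hD
  have hE : (A.map Complex.ofRealHom + C Complex.I * D.map Complex.ofRealHom).Monic :=
    (hA.map _).add_of_left hdeg
  obtain ⟨α, hα⟩ := exists_eq_prod_X_sub_C (n := n) hE (by
    rw [natDegree_add_eq_left_of_degree_lt hdeg, natDegree_map, hAn])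
  refine ⟨α, fun k => h _ ?_, hα⟩
  have h1 := congrArg (eval (α k)) hα
  rw [eval_add, eval_mul, eval_C, eval_prod,
    Finset.prod_eq_zero (Finset.mem_univ k) (by simp)] at h1
  exact h1

/-- The numerator and denominator of a sum of simple fractions have no common root. -/
theorem sub_ne_zero_of_partialFractionsNum {r x : Fin n → ℝ} (hx : Function.Injective x)
    (hr : ∀ k, r k ≠ 0) {z : ℂ}
    (h : ((∏ j, (X - C (x j))).map Complex.ofRealHom).eval z = 0 →
      ((partialFractionsNum r x).map Complex.ofRealHom).eval z = 0) (k : Fin n) :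
    z - x k ≠ 0 := by
  intro hk
  have hz : z = Complex.ofRealHom (x k) := sub_eq_zero.mp hk
  rw [hz, eval_map_apply, eval_map_apply, eval_partialFractionsNum_node, eval_prod,
    Finset.prod_eq_zero (Finset.mem_univ k) (by simp)] at h
  have h1 := h (map_zero _)
  rw [map_eq_zero, mul_eq_zero, derivative_prod_finset, eval_finsetSum,
    Finset.sum_eq_single k] at h1
  · refine h1.elim (hr k) fun h2 => ?_
    rw [eval_mul, eval_prod] at h2
    simp only [derivative_sub, derivative_X, derivative_C, sub_zero, eval_one, mul_one, eval_sub,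
      eval_X, eval_C] at h2
    obtain ⟨j, hj, hj0⟩ := Finset.prod_eq_zero_iff.mp h2
    exact (Finset.mem_erase.mp hj).1 (hx (sub_eq_zero.mp hj0)).symm
  · intro j _ hj
    rw [eval_mul, eval_prod, Finset.prod_eq_zero
      (Finset.mem_erase.mpr ⟨hj.symm, Finset.mem_univ k⟩) (by simp), zero_mul]
  · simp

/-- `A` is the product of the `X - x k` and `D` the numerator of the function. At a root of `A + iD`
the function equals `i`; a pole cannot be such a root, since `D` does not vanish there. -/
theorem exists_isHermiteBiehler_of_vanishing {r x : Fin n → ℝ} (hx : Function.Injective x)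
    (hr : ∀ k, 0 < r k) :
    ∃ (A D : ℝ[X]) (α : Fin n → ℂ), IsHermiteBiehler A D α ∧
      algebraMap ℂ[X] (RatFunc ℂ) (D.map Complex.ofRealHom) /
        algebraMap ℂ[X] (RatFunc ℂ) (A.map Complex.ofRealHom) = -partialFractions r x := by
  have hroot : ∀ w : ℂ, ((∏ k, (X - C (x k))).map Complex.ofRealHom).eval w +
      Complex.I * ((partialFractionsNum (-r) x).map Complex.ofRealHom).eval w = 0 →
      0 < w.im := by
    intro w hw
    have hne : ∀ k, w - x k ≠ 0 := sub_ne_zero_of_partialFractionsNum hx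
      (r := -r) (fun k => neg_ne_zero.mpr (hr k).ne') fun h0 => by simpa [h0] using hw
    have hF : ((∏ j, (X - C (x j))).map Complex.ofRealHom).eval w ≠ 0 := by
      rw [map_prod_X_sub_C, eval_prod]
      exact Finset.prod_ne_zero_iff.mpr fun k _ => by simpa using hne k
    rw [eval_map_partialFractionsNum _ _ hne] at hw
    refine im_pos_of_partialFractions (a := 0) (b := 0) (t := x) le_rfl hr (z := w) ?_
    refine mul_left_cancel₀ hF ?_
    simp only [Pi.neg_apply, Complex.ofReal_neg, neg_mul, Finset.sum_neg_distrib] at hw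
    rw [Complex.ofReal_zero]
    generalize ∑ k, (r k : ℂ) * (w - x k)⁻¹ = S at hw ⊢
    linear_combination (-Complex.I) * hw -
      (eval w (map Complex.ofRealHom (∏ j, (X - C (x j)))) * S) * Complex.I_sq
  obtain ⟨α, hα⟩ := isHermiteBiehler_of_roots (monic_prod_X_sub_C _ _) (by simp)
    (degree_partialFractionsNum_lt _ _) hroot
  exact ⟨_, _, α, hα, by rw [neg_partialFractions, partialFractions_eq_div]⟩

/-- Dividing by `a` makes `A` monic: `A = (X + b/a) F - N/a` and `D = -F/a`, so that `-A / D = aX +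
b - N/F`. A root of `A + iD` is again a point where this function equals `i`. -/
theorem exists_isHermiteBiehler_of_pole {m : ℕ} {a b : ℝ} {s t : Fin m → ℝ} (ha : 0 < a)
    (ht : Function.Injective t) (hs : ∀ k, 0 < s k) :
    ∃ (A D : ℝ[X]) (α : Fin (m + 1) → ℂ), IsHermiteBiehler A D α ∧
      algebraMap ℂ[X] (RatFunc ℂ) (-A.map Complex.ofRealHom) /
        algebraMap ℂ[X] (RatFunc ℂ) (D.map Complex.ofRealHom) =
      RatFunc.C (a : ℂ) * RatFunc.X + RatFunc.C (b : ℂ) - partialFractions s t := by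
  set F : ℝ[X] := ∏ k, (X - C (t k)) with hF
  have hFmonic : F.Monic := monic_prod_X_sub_C _ _
  have hFdeg : F.natDegree = m := by simp [hF]
  set N : ℝ[X] := partialFractionsNum s t with hN
  have hLF : ((X + C (a⁻¹ * b)) * F).Monic := (monic_X_add_C _).mul hFmonic
  have hLFdeg : ((X + C (a⁻¹ * b)) * F).natDegree = m + 1 := by
    rw [(monic_X_add_C _).natDegree_mul hFmonic, natDegree_X_add_C, hFdeg, add_comm]
  have hlt : (-(C a⁻¹ * N)).degree < ((X + C (a⁻¹ * b)) * F).degree := by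
    rw [degree_neg, degree_eq_natDegree hLF.ne_zero, hLFdeg]
    refine (degree_C_mul_le _ _).trans_lt ((degree_partialFractionsNum_lt s t).trans ?_)
    exact_mod_cast Nat.lt_succ_self m
  have hroot : ∀ w : ℂ, (((X + C (a⁻¹ * b)) * F + -(C a⁻¹ * N)).map Complex.ofRealHom).eval w +
      Complex.I * ((-(C a⁻¹ * F)).map Complex.ofRealHom).eval w = 0 → 0 < w.im := by
    intro w hw
    have ha0 : (a : ℂ) ≠ 0 := by exact_mod_cast ha.ne'
    simp only [Polynomial.map_mul, map_C, Polynomial.map_add, Polynomial.map_neg, map_X,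
      Complex.ofRealHom_eq_coe, Complex.ofReal_mul, Complex.ofReal_inv, eval_add, eval_mul,
      eval_neg, eval_X, eval_C] at hw
    have hne : ∀ k, w - t k ≠ 0 := sub_ne_zero_of_partialFractionsNum ht
      (fun k => (hs k).ne') fun h0 => by
        rw [← hF] at h0
        simpa [h0, ha0] using hw
    have hF0 : (F.map Complex.ofRealHom).eval w ≠ 0 := by
      rw [map_prod_X_sub_C, eval_prod]
      exact Finset.prod_ne_zero_iff.mpr fun k _ => by simpa using hne k
    rw [hN, eval_map_partialFractionsNum _ _ hne, ← hF] at hw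
    refine im_pos_of_partialFractions (b := b) ha.le hs (z := w) (t := t) ?_
    refine mul_left_cancel₀ hF0 ?_
    generalize ∑ k, (s k : ℂ) * (w - t k)⁻¹ = S at hw ⊢
    field_simp at hw
    linear_combination hw
  obtain ⟨α, hα⟩ := isHermiteBiehler_of_roots (n := m + 1)
    (A := (X + C (a⁻¹ * b)) * F + -(C a⁻¹ * N)) (D := -(C a⁻¹ * F))
    (hLF.add_of_left hlt) (by rw [natDegree_add_eq_left_of_degree_lt hlt, hLFdeg])
    (by
      rw [degree_neg]
      refine (degree_C_mul_le _ _).trans_lt ?_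
      rw [degree_eq_natDegree hFmonic.ne_zero, hFdeg]
      exact_mod_cast Nat.lt_succ_self m) hroot
  refine ⟨_, _, α, hα, ?_⟩
  have hF0 := algebraMap_prod_X_sub_C_ne_zero t
  have ha0 : RatFunc.C (a : ℂ) ≠ 0 := by
    rw [_root_.map_ne_zero]
    exact_mod_cast ha.ne'
  rw [partialFractions_eq_div]
  simp only [Polynomial.map_mul, map_mul, map_C, RatFunc.algebraMap_C, map_neg, map_add,
    Polynomial.map_add, Polynomial.map_neg, map_X, RatFunc.algebraMap_X,
    Complex.ofRealHom_eq_coe, map_inv₀]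
  rw [← hF] at hF0
  rw [← hF, ← hN]
  field_simp
  ring

/-! ### The two bijections -/

theorem isBlaschkeProduct_of_data {ε c : ℂ} {a α : Fin n → ℂ} (h : BlaschkeData ε c a α) :
    IsBlaschkeProduct n (sphereMap (blaschkeRat c a)) :=
  ⟨c, a, h.norm_eq, h.norm_lt, rfl⟩

theorem bijOn_cayleyConj_vanishing (hn : 0 < n) :
    Set.BijOn cayleyConj
      {B | IsBlaschkeProduct n B ∧ B ((1 : ℂ) : OnePoint ℂ) = ((-1 : ℂ) : OnePoint ℂ)}
      {f | IsVanishingAtInftyFun n f} := by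
  refine ⟨?_, cayleyConj_injective.injOn, ?_⟩
  · rintro B ⟨hB, h1⟩
    obtain ⟨c, a, α, h, rfl⟩ := exists_blaschkeData_of_value hB h1
    obtain ⟨A, D, hAD⟩ := h.exists_isHermiteBiehler
    obtain ⟨r, x, hx, hr, heq⟩ := hAD.exists_partialFractions_right_div_left hn
    exact ⟨r, x, hx, hr, by rw [h.cayleyConj_neg_one hAD, heq]⟩
  · rintro f ⟨r, x, hx, hr, rfl⟩
    obtain ⟨A, D, α, hAD, heq⟩ := exists_isHermiteBiehler_of_vanishing hx.injective hr
    obtain ⟨c, a, h⟩ := exists_blaschkeData_of_im_pos (ε := -1) (by simp) hAD.1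
    exact ⟨_, ⟨isBlaschkeProduct_of_data h, h.sphereMap_one⟩, by
      rw [h.cayleyConj_neg_one hAD, heq]⟩

theorem bijOn_cayleyConj_pole (m : ℕ) :
    Set.BijOn cayleyConj
      {B | IsBlaschkeProduct (m + 1) B ∧ B ((1 : ℂ) : OnePoint ℂ) = ((1 : ℂ) : OnePoint ℂ)}
      {g | IsPoleAtInftyFun m g} := by
  refine ⟨?_, cayleyConj_injective.injOn, ?_⟩
  · rintro B ⟨hB, h1⟩
    obtain ⟨c, a, α, h, rfl⟩ := exists_blaschkeData_of_value hB h1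
    obtain ⟨A, D, hAD⟩ := h.exists_isHermiteBiehler
    obtain ⟨p, q, s, t, hp, ht, hs, heq⟩ := hAD.exists_partialFractions_neg_left_div_right
    exact ⟨p, q, s, t, hp, ht, hs, by rw [h.cayleyConj_one hAD m.succ_pos, heq]⟩
  · rintro f ⟨p, q, s, t, hp, ht, hs, rfl⟩
    obtain ⟨A, D, α, hAD, heq⟩ := exists_isHermiteBiehler_of_pole (b := q) hp ht.injective hs
    obtain ⟨c, a, h⟩ := exists_blaschkeData_of_im_pos (ε := 1) (by simp) hAD.1
    exact ⟨_, ⟨isBlaschkeProduct_of_data h, h.sphereMap_one⟩, by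
      rw [h.cayleyConj_one hAD m.succ_pos, heq]⟩

end

theorem lemma1 (n : ℕ) (hn : 1 ≤ n) :
    Set.BijOn cayleyConj
      {B | IsBlaschkeProduct n B ∧ B ((1 : ℂ) : OnePoint ℂ) = ((-1 : ℂ) : OnePoint ℂ)}
      {f | IsVanishingAtInftyFun n f} ∧
    Set.BijOn cayleyConj
      {B | IsBlaschkeProduct n B ∧ B ((1 : ℂ) : OnePoint ℂ) = ((1 : ℂ) : OnePoint ℂ)}
      {g | IsPoleAtInftyFun (n - 1) g} := by
  refine ⟨bijOn_cayleyConj_vanishing hn, ?_⟩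
  obtain ⟨m, rfl⟩ := Nat.exists_eq_succ_of_ne_zero (Nat.one_le_iff_ne_zero.mp hn)
  exact bijOn_cayleyConj_pole m
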